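/- Let $R$ be an associative ring with $1$. For $n\ge 1$, an $n$-place left pp formula is a formula $\phi(\bar x)=\exists\bar y\,(A\bar y=B\bar x)$, with $A\in R^{m\times k}$ and $B\in R^{m\times n}$; for a left $R$-module $M$, $\phi(M)\subseteq M^n$ denotes its solution set. Right pp formulas $\exists\bar y\,(\bar yC=\bar xD)$ and their solution sets in right modules are defined symmetrically. A formula is below another one (and the latter is above the former) if, in every module on the respective side, the solution set of the first is contained in that of the second. A divisibility formula is a left pp formula $A\mid\bar x$, i.e. $\exists\bar y\,(A\bar y=\bar x)$; an annihilation formula is a right pp formula $\bar xA=\bar 0$. A module is absolutely pure if it is pure in every module containing it, i.e. if every embedding of it into another module reflects solutions of pp formulas. Call $R$ right a-coherent if for every unary left pp formula $\phi$ the right ideal $I=\phi({}_RR)$ contains a finitely generated right ideal $I_0$ with the same left annihilator, $\{a\in R: aI=0\}=\{a\in R: aI_0=0\}$. The following are equivalent. 1. Every injective left $R$-module is flat ($R$ is left IF). 2. The injective envelope of every finitely presented left $R$-module is flat. 3. Every finitely presented left $R$-module embeds into a free left $R$-module. 4. The character module $\mathrm{Hom}_{\mathbb Z}(F,\mathbb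 Q/\mathbb Z)$ of every free right $R$-module $F$ is a flat left $R$-module. 5. For every $n\ge1$, every $n$-place left pp formula $\phi$ has the same solution set, in every absolutely pure left $R$-module, as some divisibility formula $A\mid\bar x$ below $\phi$ (one formula for all these modules). 6. For every $n\ge1$, every $n$-place right pp formula $\psi$ has the same solution set, in every flat right $R$-module, as some annihilation formula $\bar xA=\bar 0$ above $\psi$ (one formula for all these modules). 7. $R$ is absolutely pure as a right module over itself, and $R$ is right a-coherent. Moreover, it suffices to consider unary formulas: condition 5 restricted to $n=1$, and condition 6 restricted to $n=1$, are each equivalent to the conditions above. -/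

import Mathlib

/-!
Throughout, `R` is an associative ring with `1`, a left `R`-module is a `Module R M`, and a right
`R`-module is a `Module Rᵐᵒᵖ M`, where `a r` is written `MulOpposite.op r • a`.
-/

universe u

namespace IFRing

open scoped TensorProduct

/-! ### Positive primitive formulas -/

/-- An `n`-place pp formula `∃ y (A y = B x)` for left `R`-modules. -/
structure LeftPP (R : Type u) (n : ℕ) where
  k : ℕ
  m : ℕ
  A : Matrix (Fin m) (Fin k) R
  B : Matrix (Fin m) (Fin n) R

/-- An `n`-place pp formula `∃ y (y C = x D)` for right `R`-modules. -/
structure RightPP (R : Type u) (n : ℕ) where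
  k : ℕ
  m : ℕ
  C : Matrix (Fin k) (Fin m) R
  D : Matrix (Fin n) (Fin m) R

/-- The solution set `φ(M) ⊆ Mⁿ` of a left pp formula in a left module. -/
def LeftPP.sol {R : Type u} [Ring R] {n : ℕ} (φ : LeftPP R n)
    (M : Type u) [AddCommGroup M] [Module R M] : Set (Fin n → M) :=
  {x | ∃ y : Fin φ.k → M, ∀ i, ∑ j, φ.A i j • y j = ∑ j, φ.B i j • x j}

/-- The solution set `ψ(M) ⊆ Mⁿ` of a right pp formula in a right module. -/
def RightPP.sol {R : Type u} [Ring R] {n : ℕ} (ψ : RightPP R n)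
    (M : Type u) [AddCommGroup M] [Module Rᵐᵒᵖ M] : Set (Fin n → M) :=
  {x | ∃ y : Fin ψ.k → M, ∀ j,
    ∑ i, MulOpposite.op (ψ.C i j) • y i = ∑ i, MulOpposite.op (ψ.D i j) • x i}

/-- `φ ≤ φ'` in the lattice of left pp formulas: `φ(M) ⊆ φ'(M)` for every left module `M`. -/
def LeftPP.Below {R : Type u} [Ring R] {n : ℕ} (φ φ' : LeftPP R n) : Prop :=
  ∀ (M : Type u) [AddCommGroup M] [Module R M], φ.sol M ⊆ φ'.sol M

/-- `ψ ≤ ψ'` in the lattice of right pp formulas: `ψ(M) ⊆ ψ'(M)` for every right module `M`. -/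
def RightPP.Below {R : Type u} [Ring R] {n : ℕ} (ψ ψ' : RightPP R n) : Prop :=
  ∀ (M : Type u) [AddCommGroup M] [Module Rᵐᵒᵖ M], ψ.sol M ⊆ ψ'.sol M

/-- The divisibility formula `A | x`, that is, `∃ y (A y = x)`. -/
def LeftPP.divisibility {R : Type u} [Ring R] {n k : ℕ} (A : Matrix (Fin n) (Fin k) R) :
    LeftPP R n :=
  ⟨k, n, A, 1⟩

/-- The annihilation formula `x A = 0` for right modules (no bound variables). -/
def RightPP.annihilation {R : Type u} [Ring R] {n m : ℕ} (A : Matrix (Fin n) (Fin m) R) :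
    RightPP R n :=
  ⟨0, m, 0, A⟩

/-! ### Absolutely pure modules -/

/-- An embedding of left modules is pure if it reflects the solutions of all pp formulas. -/
def PureLeft {R : Type u} [Ring R] {M N : Type u} [AddCommGroup M] [Module R M]
    [AddCommGroup N] [Module R N] (f : M →ₗ[R] N) : Prop :=
  Function.Injective f ∧
    ∀ (n : ℕ) (φ : LeftPP R n) (x : Fin n → M), (fun i => f (x i)) ∈ φ.sol N → x ∈ φ.sol M

/-- An embedding of right modules is pure if it reflects the solutions of all pp formulas. -/
def PureRight {R : Type u} [Ring R] {M N : Type u} [AddCommGroup M] [Module Rᵐᵒᵖ M]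
    [AddCommGroup N] [Module Rᵐᵒᵖ N] (f : M →ₗ[Rᵐᵒᵖ] N) : Prop :=
  Function.Injective f ∧
    ∀ (n : ℕ) (ψ : RightPP R n) (x : Fin n → M), (fun i => f (x i)) ∈ ψ.sol N → x ∈ ψ.sol M

/-- A left module is absolutely pure if every embedding of it into a left module is pure. -/
def AbsPureLeft (R : Type u) [Ring R] (M : Type u) [AddCommGroup M] [Module R M] : Prop :=
  ∀ (N : Type u) [AddCommGroup N] [Module R N] (f : M →ₗ[R] N),
    Function.Injective f → PureLeft f

/-- A right module is absolutely pure if every embedding of it into a right module is pure. -/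
def AbsPureRight (R : Type u) [Ring R] (M : Type u) [AddCommGroup M] [Module Rᵐᵒᵖ M] : Prop :=
  ∀ (N : Type u) [AddCommGroup N] [Module Rᵐᵒᵖ N] (f : M →ₗ[Rᵐᵒᵖ] N),
    Function.Injective f → PureRight f

/-! ### Tensor products over a noncommutative ring and flat modules -/

/-- The subgroup of `A ⊗[ℤ] M` generated by the elements `a r ⊗ m - a ⊗ r m`. -/
def balancing (R : Type u) [Ring R] (A M : Type u) [AddCommGroup A] [Module Rᵐᵒᵖ A]
    [AddCommGroup M] [Module R M] : Submodule ℤ (A ⊗[ℤ] M) :=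
  Submodule.span ℤ
    {t | ∃ (a : A) (r : R) (m : M),
      t = (MulOpposite.op r • a) ⊗ₜ[ℤ] m - a ⊗ₜ[ℤ] (r • m)}

/-- The tensor product `A ⊗_R M` of a right module `A` and a left module `M`, an abelian group. -/
abbrev Tensor (R : Type u) [Ring R] (A M : Type u) [AddCommGroup A] [Module Rᵐᵒᵖ A]
    [AddCommGroup M] [Module R M] : Type u :=
  (A ⊗[ℤ] M) ⧸ balancing R A M

theorem balancing_le_comap {R : Type u} [Ring R] {A A' M M' : Type u}
    [AddCommGroup A] [Module Rᵐᵒᵖ A] [AddCommGroup A'] [Module Rᵐᵒᵖ A']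
    [AddCommGroup M] [Module R M] [AddCommGroup M'] [Module R M']
    (f : A →ₗ[Rᵐᵒᵖ] A') (g : M →ₗ[R] M') :
    balancing R A M ≤ (balancing R A' M').comap
      (TensorProduct.map f.toAddMonoidHom.toIntLinearMap g.toAddMonoidHom.toIntLinearMap) := by
  refine Submodule.span_le.2 ?_
  rintro _ ⟨a, r, m, rfl⟩
  refine Submodule.subset_span ⟨f a, r, g m, ?_⟩
  simp

/-- The homomorphism `f ⊗ g : A ⊗_R M → A' ⊗_R M'`. -/
def Tensor.map {R : Type u} [Ring R] {A A' M M' : Type u}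
    [AddCommGroup A] [Module Rᵐᵒᵖ A] [AddCommGroup A'] [Module Rᵐᵒᵖ A']
    [AddCommGroup M] [Module R M] [AddCommGroup M'] [Module R M']
    (f : A →ₗ[Rᵐᵒᵖ] A') (g : M →ₗ[R] M') : Tensor R A M →ₗ[ℤ] Tensor R A' M' :=
  Submodule.mapQ (balancing R A M) (balancing R A' M')
    (TensorProduct.map f.toAddMonoidHom.toIntLinearMap g.toAddMonoidHom.toIntLinearMap)
    (balancing_le_comap f g)

/-- A left module `M` is flat if `- ⊗_R M` preserves injectivity of maps of right modules. -/
def FlatLeft (R : Type u) [Ring R] (M : Type u) [AddCommGroup M] [Module R M] : Prop :=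
  ∀ (A B : Type u) [AddCommGroup A] [Module Rᵐᵒᵖ A] [AddCommGroup B] [Module Rᵐᵒᵖ B]
    (f : A →ₗ[Rᵐᵒᵖ] B), Function.Injective f →
      Function.Injective (Tensor.map f (LinearMap.id : M →ₗ[R] M))

/-- A right module `F` is flat if `F ⊗_R -` preserves injectivity of maps of left modules. -/
def FlatRight (R : Type u) [Ring R] (F : Type u) [AddCommGroup F] [Module Rᵐᵒᵖ F] : Prop :=
  ∀ (A B : Type u) [AddCommGroup A] [Module R A] [AddCommGroup B] [Module R B]
    (f : A →ₗ[R] B), Function.Injective f →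
      Function.Injective (Tensor.map (LinearMap.id : F →ₗ[Rᵐᵒᵖ] F) f)

/-! ### Injective envelopes, character modules, a-coherence -/

/-- `f : M → E` is an injective envelope: an essential embedding into an injective module. -/
structure IsInjectiveEnvelope {R : Type u} [Ring R] {M E : Type u} [AddCommGroup M] [Module R M]
    [AddCommGroup E] [Module R E] (f : M →ₗ[R] E) : Prop where
  injective_target : Module.Injective R E
  injective_map : Function.Injective f
  essential : ∀ N : Submodule R E, N ⊓ LinearMap.range f = ⊥ → N = ⊥

/-- The character module `F⁺ = Hom_ℤ(F, ℚ/ℤ)` of a right module `F` is a left module through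
`(r c)(x) = c (x r)`. -/
instance characterModuleOfRight {R : Type u} [Ring R] {F : Type u} [AddCommGroup F]
    [Module Rᵐᵒᵖ F] : Module R (CharacterModule F) where
  smul r c := AddMonoidHom.comp c (DistribSMul.toAddMonoidHom F (MulOpposite.op r))
  one_smul c := by
    refine CharacterModule.ext _ fun x => ?_
    change c (MulOpposite.op (1 : R) • x) = c x
    simp
  mul_smul r s c := by
    refine CharacterModule.ext _ fun x => ?_
    change c (MulOpposite.op (r * s) • x) = c (MulOpposite.op s • MulOpposite.op r • x)
    rw [MulOpposite.op_mul, mul_smul]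
  smul_zero r := rfl
  smul_add r c d := rfl
  add_smul r s c := by
    refine CharacterModule.ext _ fun x => ?_
    change c (MulOpposite.op (r + s) • x) = c (MulOpposite.op r • x) + c (MulOpposite.op s • x)
    rw [MulOpposite.op_add, add_smul, map_add]
  zero_smul c := by
    refine CharacterModule.ext _ fun x => ?_
    change c (MulOpposite.op (0 : R) • x) = 0
    simp

/-- `R` is right a-coherent: for every unary left pp formula `φ`, the right ideal `φ(R)` contains a
finitely generated right ideal `I₀` with the same left annihilator. -/
def RightACoherent (R : Type u) [Ring R] : Prop :=
  ∀ φ : LeftPP R 1, ∃ I₀ : Submodule Rᵐᵒᵖ R, I₀.FG ∧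
    (∀ b ∈ I₀, (fun _ => b) ∈ φ.sol R) ∧
    {a : R | ∀ b : R, (fun _ => b) ∈ φ.sol R → a * b = 0} = {a : R | ∀ b ∈ I₀, a * b = 0}

/-! ### The pp conditions in a fixed arity -/

/-- Every `n`-place left pp formula `φ` is equivalent, in all absolutely pure left modules, to a
divisibility formula below `φ`. -/
def DivisibilityCondition (R : Type u) [Ring R] (n : ℕ) : Prop :=
  ∀ φ : LeftPP R n, ∃ (k : ℕ) (A : Matrix (Fin n) (Fin k) R),
    (LeftPP.divisibility A).Below φ ∧
    ∀ (M : Type u) [AddCommGroup M] [Module R M], AbsPureLeft R M →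
      φ.sol M = (LeftPP.divisibility A).sol M

/-- Every `n`-place right pp formula `ψ` is equivalent, in all flat right modules, to an
annihilation formula above `ψ`. -/
def AnnihilationCondition (R : Type u) [Ring R] (n : ℕ) : Prop :=
  ∀ ψ : RightPP R n, ∃ (m : ℕ) (A : Matrix (Fin n) (Fin m) R),
    ψ.Below (RightPP.annihilation A) ∧
    ∀ (F : Type u) [AddCommGroup F] [Module Rᵐᵒᵖ F], FlatRight R F →
      ψ.sol F = (RightPP.annihilation A).sol F

end IFRing

/-! A matrix `C` presents the left module `R^m / R^k C`, and this module embeds into a finite free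
module exactly when some `T` satisfies `C T = 0` and every row killed by `T` lies in the row space
of `C`. All conditions are compared with this property of matrices, `RowSpacesAreAnnihilators`.

Flatness enters through the equational criterion: every solution of `C y = 0` has the form `y = T z`
with `C T = 0`. If the presented module sits inside a module with this property, be it an injective
envelope, a character module or a free module, then the images of the generators solve `C y = 0`,
and the criterion yields `T` (`rowSpacesAreAnnihilators_of_embedding`). Conversely, given `T`, every
map from the presented module to an injective module extends to a free one, so injective modules are
flat.

On the side of formulas, `SeparatesRows R n` asks `T` to detect only the submodule of the cokernel
generated by `n` given elements. Each pp condition in arity `n` is equivalent to it: testing on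
generic solutions produces the matrices, and absolute purity or flatness transports them to
arbitrary modules. Since generators can be adjoined one at a time, arity one suffices
(`SeparatesRows.of_one`). In the condition on `R` itself, absolute purity makes row spaces double
annihilators, while a-coherence supplies the finitely many columns of the matrix. -/

namespace IFRing

open Matrix
open scoped TensorProduct

/-! ### Row spaces that are annihilators -/

/-- The linear forms on the cokernel of `C` separate the row space of `D` from zero. -/
def Separates {R : Type u} [Ring R] {ν κ μ : Type*} [Fintype ν] [Fintype κ] [Fintype μ]
    (C : Matrix κ μ R) (D : Matrix ν μ R) : Prop :=
  ∃ (p : ℕ) (T : Matrix μ (Fin p) R), C * T = 0 ∧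
    ∀ x : ν → R, x ᵥ* (D * T) = 0 → ∃ y : κ → R, x ᵥ* D = y ᵥ* C

/-- Every cokernel of a matrix has enough linear forms for all row spaces on `n` generators. -/
def SeparatesRows (R : Type u) [Ring R] (n : ℕ) : Prop :=
  ∀ (k m : ℕ) (C : Matrix (Fin k) (Fin m) R) (D : Matrix (Fin n) (Fin m) R), Separates C D

section

variable {R : Type u} [Ring R] {ν κ μ : Type*} [Fintype ν] [Fintype κ] [Fintype μ]

theorem Separates.of_fintype {π : Type*} [Fintype π] {C : Matrix κ μ R} {D : Matrix ν μ R}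
    (T : Matrix μ π R) (hT : C * T = 0)
    (h : ∀ x : ν → R, x ᵥ* (D * T) = 0 → ∃ y : κ → R, x ᵥ* D = y ᵥ* C) : Separates C D := by
  let e := Fintype.equivFin π
  refine ⟨Fintype.card π, T.submatrix id e.symm, ?_, fun x hx => h x ?_⟩
  · ext i j
    exact congrFun (congrFun hT i) (e.symm j)
  · ext j
    have := congrFun hx (e j)
    simpa [vecMul, dotProduct, Matrix.mul_apply] using this

theorem SeparatesRows.separates {n : ℕ} (h : SeparatesRows R n) (C : Matrix κ μ R)
    (D : Matrix (Fin n) μ R) : Separates C D := by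
  let e := Fintype.equivFin κ
  let f := Fintype.equivFin μ
  obtain ⟨p, T, hT, h⟩ := h _ _ (C.submatrix e.symm f.symm) (D.submatrix id f.symm)
  have hTf : T = (T.submatrix f id).submatrix f.symm id := by simp
  rw [hTf, submatrix_mul_equiv] at hT
  refine ⟨p, T.submatrix f id, ?_, fun x hx => ?_⟩
  · ext i j
    simpa using congrFun (congrFun hT (e i)) j
  · obtain ⟨y, hy⟩ := h x (by rw [hTf, submatrix_mul_equiv]; simpa using hx)
    refine ⟨y ∘ e, ?_⟩
    ext j
    have := congrFun hy (f j)
    simp only [vecMul, dotProduct, submatrix_apply, id, Equiv.symm_apply_apply] at this ⊢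
    rw [this]
    exact Fintype.sum_equiv e.symm _ _ (by simp)

/-- Filtration by one generator: `T₂` detects the remaining rows modulo `C` and the first row, `T₁`
detects multiples of the first row modulo `C`. Vanishing under `T₂` moves an element into the span
of `C` and `D₀`, where `T₁` decides. -/
theorem SeparatesRows.succ {n : ℕ} (h₁ : SeparatesRows R 1) (h : SeparatesRows R n) :
    SeparatesRows R (n + 1) := by
  intro k m C D
  let D₀ : Matrix (Fin 1) (Fin m) R := D.submatrix (fun _ => 0) id
  let D₁ : Matrix (Fin n) (Fin m) R := D.submatrix Fin.succ id
  have hD : ∀ x : Fin (n + 1) → R,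
      x ᵥ* D = (fun _ : Fin 1 => x 0) ᵥ* D₀ + (fun i => x (Fin.succ i)) ᵥ* D₁ := by
    intro x
    ext j
    simp [vecMul, dotProduct, Fin.sum_univ_succ, D₀, D₁]
  obtain ⟨p, T₁, hT₁, h₁⟩ := h₁.separates C D₀
  obtain ⟨q, T₂, hT₂, h₂⟩ := h.separates (fromRows C D₀) D₁
  rw [fromRows_mul, ← fromRows_zero] at hT₂
  replace hT₂ := fromRows_inj.eq_iff.1 hT₂
  refine Separates.of_fintype (fromCols T₁ T₂) ?_ fun x hx => ?_
  · rw [mul_fromCols, hT₁, hT₂.1]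
    exact fromCols_zero
  · rw [← vecMul_vecMul, vecMul_fromCols] at hx
    have hx₁ : (x ᵥ* D) ᵥ* T₁ = 0 := funext fun j => congrFun hx (Sum.inl j)
    have hx₂ : (x ᵥ* D) ᵥ* T₂ = 0 := funext fun j => congrFun hx (Sum.inr j)
    rw [hD, add_vecMul, vecMul_vecMul, vecMul_vecMul, hT₂.2, vecMul_zero, zero_add] at hx₂
    obtain ⟨y, hy⟩ := h₂ _ hx₂
    obtain ⟨y₁, y₂, rfl⟩ : ∃ y₁ y₂, y = Sum.elim y₁ y₂ :=
      ⟨y ∘ Sum.inl, y ∘ Sum.inr, (Sum.elim_comp_inl_inr y).symm⟩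
    rw [sumElim_vecMul_fromRows] at hy
    have hxD : x ᵥ* D = ((fun _ : Fin 1 => x 0) + y₂) ᵥ* D₀ + y₁ ᵥ* C := by
      rw [hD, hy, add_vecMul]
      abel
    rw [hxD, add_vecMul, vecMul_vecMul, vecMul_vecMul, hT₁, vecMul_zero, add_zero] at hx₁
    obtain ⟨z, hz⟩ := h₁ _ hx₁
    exact ⟨z + y₁, by rw [hxD, hz, add_vecMul]⟩

theorem SeparatesRows.of_one (h : SeparatesRows R 1) (n : ℕ) : SeparatesRows R n := by
  induction n with
  | zero =>
    intro k m C D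
    exact ⟨0, 0, by simp, fun x _ => ⟨0, by ext; simp [vecMul, dotProduct]⟩⟩
  | succ n ih => exact h.succ ih

/-- Every finitely presented left module embeds into a free one, in terms of matrices. -/
def RowSpacesAreAnnihilators (R : Type u) [Ring R] : Prop :=
  ∀ (k m : ℕ) (C : Matrix (Fin k) (Fin m) R), ∃ (p : ℕ) (T : Matrix (Fin m) (Fin p) R),
    C * T = 0 ∧ ∀ x : Fin m → R, x ᵥ* T = 0 → ∃ y : Fin k → R, x = y ᵥ* C

theorem RowSpacesAreAnnihilators.separatesRows (h : RowSpacesAreAnnihilators R) (n : ℕ) :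
    SeparatesRows R n := by
  intro k m C D
  obtain ⟨p, T, hT, h⟩ := h k m C
  exact ⟨p, T, hT, fun x hx => h _ (by rw [vecMul_vecMul, hx])⟩

theorem SeparatesRows.rowSpacesAreAnnihilators (h : SeparatesRows R 1) :
    RowSpacesAreAnnihilators R := by
  intro k m C
  -- With the identity as `D`, all of `R^m` is separated modulo the rows of `C`.
  obtain ⟨p, T, hT, h⟩ := h.of_one m k m C 1
  refine ⟨p, T, hT, fun x hx => ?_⟩
  simpa using h x (by rwa [Matrix.one_mul])

end

/-! ### Tensor products over a noncommutative ring -/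

section

variable {R : Type u} [Ring R] {A A' M M' : Type u}
  [AddCommGroup A] [Module Rᵐᵒᵖ A] [AddCommGroup A'] [Module Rᵐᵒᵖ A']
  [AddCommGroup M] [Module R M] [AddCommGroup M'] [Module R M']

variable (R) in
/-- The elementary tensor `a ⊗ m`. -/
def tmul (a : A) (m : M) : Tensor R A M :=
  (balancing R A M).mkQ (a ⊗ₜ[ℤ] m)

theorem tmul_add (a : A) (m m' : M) : tmul R a (m + m') = tmul R a m + tmul R a m' := by
  simp only [tmul, TensorProduct.tmul_add, map_add]

theorem add_tmul (a a' : A) (m : M) : tmul R (a + a') m = tmul R a m + tmul R a' m := by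
  simp only [tmul, TensorProduct.add_tmul, map_add]

@[simp] theorem tmul_zero (a : A) : tmul R a (0 : M) = 0 := by
  simp only [tmul, TensorProduct.tmul_zero, map_zero]

@[simp] theorem zero_tmul (m : M) : tmul R (0 : A) m = 0 := by
  simp only [tmul, TensorProduct.zero_tmul, map_zero]

theorem tmul_sum {ι : Type*} (s : Finset ι) (a : A) (m : ι → M) :
    tmul R a (∑ i ∈ s, m i) = ∑ i ∈ s, tmul R a (m i) := by
  simp only [tmul, TensorProduct.tmul_sum, map_sum]

theorem sum_tmul {ι : Type*} (s : Finset ι) (a : ι → A) (m : M) :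
    tmul R (∑ i ∈ s, a i) m = ∑ i ∈ s, tmul R (a i) m := by
  simp only [tmul, TensorProduct.sum_tmul, map_sum]

theorem op_smul_tmul (r : R) (a : A) (m : M) :
    tmul R (MulOpposite.op r • a) m = tmul R a (r • m) := by
  rw [← sub_eq_zero]
  simp only [tmul, ← map_sub]
  rw [← LinearMap.mem_ker, Submodule.ker_mkQ]
  exact Submodule.subset_span ⟨a, r, m, rfl⟩

@[simp] theorem Tensor.map_tmul (f : A →ₗ[Rᵐᵒᵖ] A') (g : M →ₗ[R] M') (a : A) (m : M) :
    Tensor.map f g (tmul R a m) = tmul R (f a) (g m) := rfl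

/-- A biadditive map as a `ℤ`-bilinear one. -/
def biadditive {X Y G : Type*} [AddCommGroup X] [AddCommGroup Y] [AddCommGroup G]
    (f : X → Y → G) (h₁ : ∀ x x' y, f (x + x') y = f x y + f x' y)
    (h₂ : ∀ x y y', f x (y + y') = f x y + f x y') : X →ₗ[ℤ] Y →ₗ[ℤ] G :=
  (AddMonoidHom.mk' (fun x => (AddMonoidHom.mk' (f x) (h₂ x)).toIntLinearMap)
    fun x x' => LinearMap.ext (h₁ x x')).toIntLinearMap

/-- The homomorphism out of the tensor product given by a balanced biadditive map. -/
def Tensor.lift {G : Type*} [AddCommGroup G] (b : A →ₗ[ℤ] M →ₗ[ℤ] G)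
    (hb : ∀ (a : A) (r : R) (m : M), b (MulOpposite.op r • a) m = b a (r • m)) :
    Tensor R A M →ₗ[ℤ] G :=
  Submodule.liftQ _ (TensorProduct.lift b) <| Submodule.span_le.2 <| by
    rintro _ ⟨a, r, m, rfl⟩
    change TensorProduct.lift b _ = 0
    rw [map_sub, TensorProduct.lift.tmul, TensorProduct.lift.tmul, hb, sub_self]

@[simp] theorem Tensor.lift_tmul {G : Type*} [AddCommGroup G] (b : A →ₗ[ℤ] M →ₗ[ℤ] G)
    (hb : ∀ (a : A) (r : R) (m : M), b (MulOpposite.op r • a) m = b a (r • m)) (a : A) (m : M) :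
    Tensor.lift b hb (tmul R a m) = b a m := by
  exact TensorProduct.lift.tmul a m

theorem exists_eq_sum_tmul (t : Tensor R A M) :
    ∃ (k : ℕ) (a : Fin k → A) (m : Fin k → M), t = ∑ i, tmul R (a i) (m i) := by
  obtain ⟨t, rfl⟩ := Submodule.mkQ_surjective _ t
  induction t using TensorProduct.induction_on with
  | zero => exact ⟨0, 0, 0, by simp⟩
  | tmul a m => exact ⟨1, fun _ => a, fun _ => m, by simp [tmul]⟩
  | add s t hs ht =>
    obtain ⟨k, a, m, hs⟩ := hs
    obtain ⟨l, a', m', ht⟩ := ht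
    refine ⟨k + l, Fin.append a a', Fin.append m m', ?_⟩
    rw [map_add, hs, ht]
    simp [Fin.sum_univ_add]

/-- If `∑ bᵢ ⊗ mᵢ = 0` and the `bᵢ` generate the right module, then `m` is a combination of
relations between the `bᵢ`. -/
theorem exists_relations_of_sum_tmul_eq_zero {ι : Type*} (b : ι → A)
    (hb : ∀ a : A, ∃ c : ι →₀ R, c.sum (fun i r => MulOpposite.op r • b i) = a)
    (m : ι →₀ M) (hm : m.sum (fun i y => tmul R (b i) y) = 0) :
    ∃ (l : ℕ) (κ : Fin l → ι →₀ R) (z : Fin l → M),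
      (∀ j, (κ j).sum (fun i r => MulOpposite.op r • b i) = 0) ∧
      ∀ i, m i = ∑ j, κ j i • z j := by
  classical
  let π : (ι →₀ R) →+ A :=
    Finsupp.liftAddHom fun i => (AddMonoidHom.flip (smulAddHom Rᵐᵒᵖ A) (b i)).comp
      MulOpposite.opAddEquiv.toAddMonoidHom
  have hπ : ∀ c : ι →₀ R, π c = c.sum (fun i r => MulOpposite.op r • b i) := fun c => rfl
  have hπr : ∀ (r : R) (c : ι →₀ R), π (c.mapRange (· * r) (zero_mul r)) =
      MulOpposite.op r • π c := by
    intro r c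
    rw [hπ, hπ, Finsupp.sum_mapRange_index (by simp), Finsupp.smul_sum]
    simp [mul_smul]
  let act : (ι →₀ R) →ₗ[ℤ] M →ₗ[ℤ] (ι →₀ M) :=
    biadditive (fun c z => c.mapRange (· • z) (zero_smul R z))
      (by intros; ext; simp [add_smul]) (by intros; ext; simp)
  have hact : ∀ c z i, act c z i = c i • z := fun c z i => rfl
  -- By right exactness the quotient by `N` is a model of `A ⊗ M`. The section `s` chosen below need
  -- not be additive: two lifts of one element agree modulo `N`, so `L` is well defined.
  let N : Submodule ℤ (ι →₀ M) := Submodule.span ℤ {t | ∃ c z, π c = 0 ∧ t = act c z}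
  have hN : ∀ c c' z, π c = π c' → N.mkQ (act c z) = N.mkQ (act c' z) := by
    intro c c' z h
    rw [← sub_eq_zero, ← map_sub, ← LinearMap.mem_ker, Submodule.ker_mkQ]
    exact Submodule.subset_span ⟨c - c', z, by simp [h], by simp⟩
  choose s hs using hb
  replace hs : ∀ a, π (s a) = a := hs
  let β : A →ₗ[ℤ] M →ₗ[ℤ] (ι →₀ M) ⧸ N :=
    biadditive (fun a z => N.mkQ (act (s a) z))
      (fun a a' z => by
        rw [← map_add, ← LinearMap.add_apply, ← map_add]
        exact hN _ _ _ (by simp [hs]))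
      (fun a z z' => by rw [map_add, map_add])
  have hβ : ∀ a z, β a z = N.mkQ (act (s a) z) := fun _ _ => rfl
  let L : Tensor R A M →ₗ[ℤ] (ι →₀ M) ⧸ N := Tensor.lift β fun a r z => by
    rw [hβ, hβ, hN _ ((s a).mapRange (· * r) (zero_mul r)) z (by rw [hπr, hs, hs])]
    congr 1
    ext i
    simp [hact, mul_smul]
  have hLm : N.mkQ m = L (m.sum fun i y => tmul R (b i) y) := by
    conv_lhs => rw [← Finsupp.sum_single m]
    rw [Finsupp.sum, Finsupp.sum, map_sum, map_sum]
    refine Finset.sum_congr rfl fun i _ => ?_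
    rw [Tensor.lift_tmul, hβ, hN _ (Finsupp.single i 1) _ (by simp [hs, hπ])]
    congr 1
    ext j
    rw [hact]
    by_cases h : i = j
    · subst h; simp
    · simp [Finsupp.single_eq_of_ne' h]
  rw [hm, map_zero, ← LinearMap.mem_ker, Submodule.ker_mkQ, Submodule.mem_span_set'] at hLm
  obtain ⟨l, n, g, hg⟩ := hLm
  choose κ z hκ hz using fun j => (g j).2
  refine ⟨l, κ, fun j => n j • z j, hκ, fun i => ?_⟩
  rw [← hg, Finsupp.finsetSum_apply]
  refine Finset.sum_congr rfl fun j _ => ?_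
  rw [hz, Finsupp.smul_apply, hact, smul_comm]

/-- If `∑ yᵢ ⊗ bᵢ = 0` and the `bᵢ` generate the left module, then `y` is a combination of
relations between the `bᵢ`. -/
theorem exists_relations_of_sum_tmul_eq_zero' {ι : Type*} (b : ι → M)
    (hb : ∀ x : M, ∃ c : ι →₀ R, c.sum (fun i r => r • b i) = x)
    (m : ι →₀ A) (hm : m.sum (fun i y => tmul R y (b i)) = 0) :
    ∃ (l : ℕ) (κ : Fin l → ι →₀ R) (z : Fin l → A),
      (∀ j, (κ j).sum (fun i r => r • b i) = 0) ∧
      ∀ i, m i = ∑ j, MulOpposite.op (κ j i) • z j := by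
  classical
  let π : (ι →₀ R) →ₗ[R] M := Finsupp.linearCombination R b
  have hπ : ∀ c : ι →₀ R, π c = c.sum (fun i r => r • b i) := fun c => rfl
  let act : (ι →₀ R) →ₗ[ℤ] A →ₗ[ℤ] (ι →₀ A) :=
    biadditive (fun c z => c.mapRange (fun r => MulOpposite.op r • z) (by simp))
      (by intros; ext; simp [add_smul]) (by intros; ext; simp)
  have hact : ∀ c z i, act c z i = MulOpposite.op (c i) • z := fun c z i => rfl
  let N : Submodule ℤ (ι →₀ A) := Submodule.span ℤ {t | ∃ c z, π c = 0 ∧ t = act c z}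
  have hN : ∀ c c' z, π c = π c' → N.mkQ (act c z) = N.mkQ (act c' z) := by
    intro c c' z h
    rw [← sub_eq_zero, ← map_sub, ← LinearMap.mem_ker, Submodule.ker_mkQ]
    exact Submodule.subset_span ⟨c - c', z, by simp [h], by simp⟩
  choose s hs using hb
  replace hs : ∀ a, π (s a) = a := hs
  let β : M →ₗ[ℤ] A →ₗ[ℤ] (ι →₀ A) ⧸ N :=
    biadditive (fun a z => N.mkQ (act (s a) z))
      (fun a a' z => by
        rw [← map_add, ← LinearMap.add_apply, ← map_add]
        exact hN _ _ _ (by simp [hs]))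
      (fun a z z' => by rw [map_add, map_add])
  have hβ : ∀ a z, β a z = N.mkQ (act (s a) z) := fun _ _ => rfl
  let L : Tensor R A M →ₗ[ℤ] (ι →₀ A) ⧸ N := Tensor.lift β.flip fun z r a => by
    rw [LinearMap.flip_apply, LinearMap.flip_apply, hβ, hβ,
      hN (s (r • a)) (r • s a) z (by rw [map_smul, hs, hs])]
    congr 1
    ext i
    simp [hact, mul_smul]
  have hLm : N.mkQ m = L (m.sum fun i y => tmul R y (b i)) := by
    conv_lhs => rw [← Finsupp.sum_single m]
    rw [Finsupp.sum, Finsupp.sum, map_sum, map_sum]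
    refine Finset.sum_congr rfl fun i _ => ?_
    rw [Tensor.lift_tmul, LinearMap.flip_apply, hβ,
      hN _ (Finsupp.single i 1) _ (by simp [hs, hπ])]
    congr 1
    ext j
    rw [hact]
    by_cases h : i = j
    · subst h; simp
    · simp [Finsupp.single_eq_of_ne' h]
  rw [hm, map_zero, ← LinearMap.mem_ker, Submodule.ker_mkQ, Submodule.mem_span_set'] at hLm
  obtain ⟨l, n, g, hg⟩ := hLm
  choose κ z hκ hz using fun j => (g j).2
  refine ⟨l, κ, fun j => n j • z j, hκ, fun i => ?_⟩
  rw [← hg, Finsupp.finsetSum_apply]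
  refine Finset.sum_congr rfl fun j _ => ?_
  rw [hz, Finsupp.smul_apply, hact, smul_comm]

/-! ### The equational criterion for flatness -/

/-- The equational criterion for flatness of a left module. -/
def Equational (R : Type u) [Ring R] (M : Type u) [AddCommGroup M] [Module R M] : Prop :=
  ∀ (k m : ℕ) (C : Matrix (Fin k) (Fin m) R) (y : Fin m → M),
    (∀ i, ∑ j, C i j • y j = 0) → ∃ (p : ℕ) (Y : Matrix (Fin m) (Fin p) R) (z : Fin p → M),
      C * Y = 0 ∧ ∀ j, y j = ∑ l, Y j l • z l

/-- Let `I` be generated by the columns of `C`. The equations `C y = 0` say that the sum of column ⊗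
`y j` vanishes in `R^k ⊗ M`; flatness makes it vanish in `I ⊗ M`, and the relations between the
columns form `Y`. -/
theorem FlatLeft.equational (hM : FlatLeft R M) : Equational R M := by
  intro k m C y hy
  let I : Submodule Rᵐᵒᵖ (Fin k → R) := Submodule.span Rᵐᵒᵖ (Set.range fun j i => C i j)
  let b : Fin m → I := fun j => ⟨fun i => C i j, Submodule.subset_span ⟨j, rfl⟩⟩
  have hb : ∀ a : I, ∃ c : Fin m →₀ R, c.sum (fun i r => MulOpposite.op r • b i) = a := by
    rintro ⟨a, ha⟩
    obtain ⟨c, hc⟩ := (Submodule.mem_span_range_iff_exists_fun _).1 ha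
    refine ⟨Finsupp.equivFunOnFinite.symm fun j => (c j).unop, Subtype.ext ?_⟩
    rw [Finsupp.sum_fintype _ _ (by simp)]
    simpa [b] using hc
  have h₀ : ∑ j, tmul R (b j) (y j) = 0 := by
    apply hM I (Fin k → R) I.subtype I.injective_subtype
    have hcol : ∀ j, (fun i => C i j) =
        ∑ i, MulOpposite.op (C i j) • (Pi.single i 1 : Fin k → R) := by
      intro j
      ext i
      simp [Finset.sum_apply, Pi.single_apply]
    simp only [map_sum, Tensor.map_tmul, map_zero, LinearMap.id_apply, Submodule.subtype_apply, b]
    simp_rw [hcol, sum_tmul, op_smul_tmul]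
    rw [Finset.sum_comm]
    simp_rw [← tmul_sum, hy, tmul_zero, Finset.sum_const_zero]
  obtain ⟨l, κ, z, hκ, hz⟩ := exists_relations_of_sum_tmul_eq_zero b hb
    (Finsupp.equivFunOnFinite.symm y) (by rw [Finsupp.sum_fintype _ _ (by simp)]; simpa using h₀)
  refine ⟨l, Matrix.of fun i j => κ j i, z, ?_, fun i => by simpa using hz i⟩
  ext i j
  have := congrArg (fun t : I => (t : Fin k → R) i) (hκ j)
  rw [Finsupp.sum_fintype _ _ (by simp)] at this
  simpa [b, Matrix.mul_apply] using this

theorem Equational.flatLeft (hM : Equational R M) : FlatLeft R M := by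
  intro A B _ _ _ _ f hf
  rw [injective_iff_map_eq_zero]
  intro t ht
  obtain ⟨k, a, m, rfl⟩ := exists_eq_sum_tmul t
  simp only [map_sum, Tensor.map_tmul, LinearMap.id_apply] at ht
  -- All elements of `B` are adjoined to the `f (a i)`, so generation is automatic. At the adjoined
  -- generators the tensor has coefficient zero, and this gives the equations for `z` to which the
  -- criterion is applied.
  let b : Fin k ⊕ B → B := Sum.elim (fun i => f (a i)) id
  obtain ⟨l, κ, z, hκ, hz⟩ := exists_relations_of_sum_tmul_eq_zero (R := R) b
    (fun x => ⟨Finsupp.single (Sum.inr x) 1, by simp [b]⟩)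
    ((Finsupp.equivFunOnFinite.symm m).mapDomain Sum.inl : Fin k ⊕ B →₀ M) (by
      rw [Finsupp.sum_mapDomain_index (by simp) (by simp [tmul_add]),
        Finsupp.sum_fintype _ _ (by simp)]
      simpa [b] using ht)
  classical
  let S : Finset B := Finset.univ.biUnion fun j => (Finsupp.comapDomain Sum.inr (κ j)
    Sum.inr_injective.injOn).support
  obtain ⟨p, Y, w, hY, hw⟩ := hM S.card l
    (Matrix.of fun s j => κ j (Sum.inr (S.equivFin.symm s : B))) z (by
    intro s
    refine (hz (Sum.inr (S.equivFin.symm s))).symm.trans ?_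
    rw [Finsupp.mapDomain_of_notMem_range]
    simp)
  have hm : ∀ i, m i = ∑ j, κ j (Sum.inl i) • z j := by
    intro i
    rw [← hz, Finsupp.mapDomain_apply Sum.inl_injective]
    simp
  have hrel : ∀ j, ∑ i, MulOpposite.op (κ j (Sum.inl i)) • f (a i) +
      ∑ s ∈ S, MulOpposite.op (κ j (Sum.inr s)) • s = 0 := by
    intro j
    have hsub : (κ j).support ⊆ (Finset.univ : Finset (Fin k)).disjSum S := by
      rintro (i | s) hs
      · simp
      · simp only [Finset.inr_mem_disjSum, S, Finset.mem_biUnion]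
        exact ⟨j, Finset.mem_univ j, by simpa using hs⟩
    rw [← hκ j, Finsupp.sum_of_support_subset _ hsub _ (by simp), Finset.sum_disjSum]
    simp [b]
  -- Multiplying the relations by `Y` cancels the adjoined generators, leaving relations between the
  -- `f (a i)` alone, which injectivity pulls back to `A`.
  have hzero : ∀ q, ∑ i, MulOpposite.op (∑ j, κ j (Sum.inl i) * Y j q) • a i = 0 := by
    intro q
    apply hf
    have h₁ : ∑ j, MulOpposite.op (Y j q) • (∑ i, MulOpposite.op (κ j (Sum.inl i)) • f (a i) +
      ∑ s ∈ S, MulOpposite.op (κ j (Sum.inr s)) • s) = 0 := by simp [hrel]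
    have h₂ : ∀ s ∈ S, ∑ j, κ j (Sum.inr s) * Y j q = 0 := by
      intro s hs
      have := congrFun (congrFun hY (S.equivFin ⟨s, hs⟩)) q
      simpa [Matrix.mul_apply] using this
    simp_rw [smul_add, Finset.sum_add_distrib, Finset.smul_sum, ← mul_smul,
      ← MulOpposite.op_mul] at h₁
    rw [Finset.sum_comm, Finset.sum_comm (s := Finset.univ) (t := S)] at h₁
    simp_rw [← Finset.sum_smul, ← Finset.op_sum] at h₁
    rw [Finset.sum_eq_zero (s := S) fun s hs => by rw [h₂ s hs, MulOpposite.op_zero, zero_smul],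
      add_zero] at h₁
    simpa using h₁
  have hm' : ∀ i, m i = ∑ q, (∑ j, κ j (Sum.inl i) * Y j q) • w q := by
    intro i
    simp_rw [hm, hw, Finset.smul_sum, Finset.sum_smul, mul_smul]
    exact Finset.sum_comm
  simp_rw [hm', tmul_sum, ← op_smul_tmul]
  rw [Finset.sum_comm]
  simp_rw [← sum_tmul, hzero, zero_tmul, Finset.sum_const_zero]

theorem FlatRight.equational (hA : FlatRight R A) {k m : ℕ} (C : Matrix (Fin k) (Fin m) R)
    (y : Fin k → A) (hy : ∀ j, ∑ i, MulOpposite.op (C i j) • y i = 0) :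
    ∃ (p : ℕ) (Y : Matrix (Fin p) (Fin k) R) (z : Fin p → A),
      Y * C = 0 ∧ ∀ i, y i = ∑ l, MulOpposite.op (Y l i) • z l := by
  let I : Submodule R (Fin m → R) := Submodule.span R (Set.range C)
  let b : Fin k → I := fun i => ⟨C i, Submodule.subset_span ⟨i, rfl⟩⟩
  have hb : ∀ a : I, ∃ c : Fin k →₀ R, c.sum (fun i r => r • b i) = a := by
    rintro ⟨a, ha⟩
    obtain ⟨c, hc⟩ := (Submodule.mem_span_range_iff_exists_fun _).1 ha
    refine ⟨Finsupp.equivFunOnFinite.symm c, Subtype.ext ?_⟩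
    rw [Finsupp.sum_fintype _ _ (by simp)]
    simpa [b] using hc
  have h₀ : ∑ i, tmul R (y i) (b i) = 0 := by
    apply hA I (Fin m → R) I.subtype I.injective_subtype
    have hrow : ∀ i, C i = ∑ j, C i j • (Pi.single j 1 : Fin m → R) := by
      intro i
      ext j
      simp [Finset.sum_apply, Pi.single_apply]
    simp only [map_sum, Tensor.map_tmul, map_zero, LinearMap.id_apply, Submodule.subtype_apply, b]
    rw [Finset.sum_congr rfl fun i _ => by rw [hrow i, tmul_sum]]
    simp_rw [← op_smul_tmul]
    rw [Finset.sum_comm]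
    simp_rw [← sum_tmul, hy, zero_tmul, Finset.sum_const_zero]
  obtain ⟨l, κ, z, hκ, hz⟩ := exists_relations_of_sum_tmul_eq_zero' b hb
    (Finsupp.equivFunOnFinite.symm y) (by rw [Finsupp.sum_fintype _ _ (by simp)]; simpa using h₀)
  refine ⟨l, Matrix.of fun j i => κ j i, z, ?_, fun i => by simpa using hz i⟩
  ext i j
  have := congrArg (fun t : I => (t : Fin m → R) j) (hκ i)
  rw [Finsupp.sum_fintype _ _ (by simp)] at this
  simpa [b, Matrix.mul_apply] using this

variable (R) in
theorem flatRight_self : FlatRight R R := by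
  intro A B _ _ _ _ f hf
  rw [injective_iff_map_eq_zero]
  intro t ht
  obtain ⟨k, r, a, rfl⟩ := exists_eq_sum_tmul t
  have key : ∀ (X : Type u) [AddCommGroup X] [Module R X] (x : Fin k → X),
      ∑ i, tmul R (r i) (x i) = tmul R (1 : R) (∑ i, r i • x i) := by
    intro X _ _ x
    simp_rw [tmul_sum, ← op_smul_tmul]
    simp
  simp only [map_sum, Tensor.map_tmul, LinearMap.id_apply] at ht
  rw [key] at ht ⊢
  let β : R →ₗ[ℤ] B →ₗ[ℤ] B := biadditive (fun r x => r • x) add_smul smul_add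
  have h₁ : (1 : R) • ∑ i, r i • f (a i) = 0 :=
    (congrArg (Tensor.lift β fun a r x => mul_smul a r x) ht).trans (map_zero _)
  have h : f (∑ i, r i • a i) = 0 := by simpa using h₁
  rw [(map_eq_zero_iff f hf).1 h, tmul_zero]

end

/-! ### Injective modules and character modules -/

section

variable {R : Type u} [Ring R]

/-- The homomorphism `Y → F⁺` given by a character of `Y` for each basis element of `F`. -/
noncomputable def toCharacterModule {F : Type u} [AddCommGroup F] [Module Rᵐᵒᵖ F] {ι : Type*}
    (B : Module.Basis ι Rᵐᵒᵖ F) {Y : Type u} [AddCommGroup Y] [Module R Y]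
    (d : ι → CharacterModule Y) : Y →ₗ[R] CharacterModule F where
  toFun y := (Finsupp.liftAddHom fun i : ι => AddMonoidHom.mk'
    (fun r : Rᵐᵒᵖ => d i (r.unop • y)) fun r s => by
      rw [MulOpposite.unop_add, add_smul, map_add]).comp B.repr.toAddEquiv.toAddMonoidHom
  map_add' y y' := by
    refine CharacterModule.ext _ fun x => ?_
    change ((B.repr x).sum fun i r => d i (r.unop • (y + y'))) =
      ((B.repr x).sum fun i r => d i (r.unop • y)) + (B.repr x).sum fun i r => d i (r.unop • y')
    rw [← Finsupp.sum_add]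
    simp_rw [smul_add, map_add]
  map_smul' r y := by
    refine CharacterModule.ext _ fun x => ?_
    change (B.repr x).sum _ = (B.repr (MulOpposite.op r • x)).sum _
    rw [map_smul, Finsupp.sum_smul_index (by intro i; exact map_zero _)]
    refine Finsupp.sum_congr fun i _ => ?_
    change d i _ = d i _
    simp [mul_smul]

theorem toCharacterModule_apply_smul_basis {F : Type u} [AddCommGroup F] [Module Rᵐᵒᵖ F]
    {ι : Type*} (B : Module.Basis ι Rᵐᵒᵖ F) {Y : Type u} [AddCommGroup Y] [Module R Y]
    (d : ι → CharacterModule Y) (y : Y) (i : ι) (r : Rᵐᵒᵖ) :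
    toCharacterModule B d y (r • B i) = d i (r.unop • y) := by
  change (B.repr (r • B i)).sum _ = _
  rw [map_smul, B.repr_self, Finsupp.smul_single, Finsupp.sum_single_index]
  · change d i _ = _
    simp
  · exact map_zero _

/-- A map into `F⁺` amounts to one character for each basis element of `F`, and characters extend
along embeddings because `ℚ/ℤ` is divisible. -/
theorem injective_characterModule (F : Type u) [AddCommGroup F] [Module Rᵐᵒᵖ F]
    [Module.Free Rᵐᵒᵖ F] : Module.Injective R (CharacterModule F) where
  out X Y _ _ _ _ f hf g := by
    let B := Module.Free.chooseBasis Rᵐᵒᵖ F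
    let c : Module.Free.ChooseBasisIndex Rᵐᵒᵖ F → CharacterModule X := fun i =>
      AddMonoidHom.mk' (fun x => g x (B i)) fun x x' => by rw [map_add]; rfl
    have hc : ∀ i x, c i x = g x (B i) := fun i x => rfl
    choose d hd using fun i => CharacterModule.dual_surjective_of_injective (R := ℤ)
      f.toAddMonoidHom.toIntLinearMap hf (c i)
    have hd' : ∀ i x, d i (f x) = c i x := fun i x => by rw [← hd]; rfl
    refine ⟨toCharacterModule B d, fun x => ?_⟩
    refine CharacterModule.ext _ fun t => ?_
    rw [← B.linearCombination_repr t]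
    induction B.repr t using Finsupp.induction_linear with
    | zero => rw [map_zero, map_zero, map_zero]
    | add s t hs ht => rw [map_add, map_add, map_add, hs, ht]
    | single i r =>
      rw [Finsupp.linearCombination_single, toCharacterModule_apply_smul_basis, ← map_smul,
        hd', hc, map_smul]
      rfl

/-- A free right module whose character module contains the left module `M`. -/
abbrev CharacterCover (R : Type u) [Ring R] (M : Type u) [AddCommGroup M] : Type u :=
  CharacterModule M →₀ Rᵐᵒᵖ

variable (R) in
-- The free module has one basis element per character of `M`, and characters separate points.
theorem exists_embedding_characterModule (M : Type u) [AddCommGroup M] [Module R M] :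
    ∃ f : M →ₗ[R] CharacterModule (CharacterCover R M), Function.Injective f := by
  refine ⟨toCharacterModule Finsupp.basisSingleOne id, ?_⟩
  rw [injective_iff_map_eq_zero]
  intro x hx
  refine CharacterModule.eq_zero_of_character_apply fun c => ?_
  have := toCharacterModule_apply_smul_basis (R := R)
    (Finsupp.basisSingleOne : Module.Basis _ Rᵐᵒᵖ (CharacterCover R M)) id x c 1
  rw [hx] at this
  simpa using this.symm.trans (AddMonoidHom.zero_apply _)

/-! ### Injective envelopes -/

theorem exists_maximal_disjoint {E : Type u} [AddCommGroup E] [Module R E] (N : Submodule R E) :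
    ∃ K : Submodule R E, Maximal (fun K => Disjoint N K) K := by
  obtain ⟨K, -, hK⟩ := zorn_le_nonempty₀ {K : Submodule R E | Disjoint N K} (fun c hc hchain K hK =>
    ⟨sSup c, (hchain.directedOn.disjoint_sSup_right).2 hc, fun _ => le_sSup⟩) ⊥ disjoint_bot_right
  exact ⟨K, hK⟩

/-- The inclusion of `N` extends along `N → E / K`, with `K` maximal disjoint from `N`, to an
endomorphism `φ` of `E` fixing `N` and killing `K`. Maximality of `K` makes the range of `φ`
essential over the image of `P`, so maximality of `N` forces the range into `N`. Hence `N` is a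
retract of `E`. -/
theorem exists_isInjectiveEnvelope_of_injective {P E : Type u} [AddCommGroup P] [Module R P]
    [AddCommGroup E] [Module R E] (hE : Module.Injective R E) (f : P →ₗ[R] E)
    (hf : Function.Injective f) :
    ∃ (N : Submodule R E) (g : P →ₗ[R] N), IsInjectiveEnvelope g := by
  -- a maximal essential extension of the image inside `E`
  obtain ⟨N, hfN, ⟨-, hN⟩, hmax⟩ := zorn_le_nonempty₀
    {N : Submodule R E | LinearMap.range f ≤ N ∧
      ∀ K ≤ N, Disjoint K (LinearMap.range f) → K = ⊥}
    (fun c hc hchain N hN => by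
      refine ⟨sSup c, ⟨(hc hN).1.trans (le_sSup hN), fun K hK hdisj => ?_⟩, fun _ => le_sSup⟩
      have : Disjoint K (sSup c) := (hchain.directedOn.disjoint_sSup_right).2 fun L hL =>
        disjoint_iff.2 ((hc hL).2 _ inf_le_right (hdisj.mono_left inf_le_left))
      exact this.eq_bot_of_le hK)
    (LinearMap.range f) ⟨le_rfl, fun K hK h => h.eq_bot_of_le hK⟩
  obtain ⟨K, hNK, hK⟩ := exists_maximal_disjoint N
  obtain ⟨h, hh⟩ := hE.out (K.mkQ ∘ₗ N.subtype) (by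
    rw [← LinearMap.ker_eq_bot, LinearMap.ker_comp, Submodule.ker_mkQ,
      ← Submodule.disjoint_iff_comap_eq_bot]
    exact hNK) N.subtype
  let φ : E →ₗ[R] E := h ∘ₗ K.mkQ
  have hφN : ∀ x ∈ N, φ x = x := fun x hx => hh ⟨x, hx⟩
  have hφK : K ≤ LinearMap.ker φ := by
    intro x hx
    rw [LinearMap.mem_ker, LinearMap.comp_apply, Submodule.mkQ_apply,
      (Submodule.Quotient.mk_eq_zero K).2 hx, map_zero]
  have hφ : LinearMap.range φ ≤ N := by
    refine hmax ⟨fun x hx => ⟨x, hφN x (hfN hx)⟩, fun L hL hdisj => ?_⟩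
      fun x hx => ⟨x, hφN x hx⟩
    have hLN : Disjoint N L := by
      rw [disjoint_comm, disjoint_iff]
      exact hN _ inf_le_right (hdisj.mono_left inf_le_left)
    have hle : L.comap φ ≤ K := by
      refine hK ?_ fun x hx => ?_
      · rw [Submodule.disjoint_def] at hLN ⊢
        intro x hx hxL
        rw [Submodule.mem_comap, hφN x hx] at hxL
        exact hLN x hx hxL
      · rw [Submodule.mem_comap, LinearMap.mem_ker.1 (hφK hx)]
        exact L.zero_mem
    rw [eq_bot_iff]
    intro y hy
    obtain ⟨x, rfl⟩ := hL hy
    exact (Submodule.mem_bot R).2 (hφK (hle hy))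
  let ρ : E →ₗ[R] N := φ.codRestrict N fun x => hφ ⟨x, rfl⟩
  refine ⟨N, f.codRestrict N fun x => hfN ⟨x, rfl⟩, ⟨⟨?_⟩, ?_, ?_⟩⟩
  · intro X Y _ _ _ _ i hi g
    obtain ⟨k, hk⟩ := hE.out i hi (N.subtype ∘ₗ g)
    refine ⟨ρ ∘ₗ k, fun x => Subtype.ext ?_⟩
    change φ (k (i x)) = g x
    rw [hk]
    exact hφN _ (g x).2
  · exact fun x y hxy => hf (congrArg Subtype.val hxy)
  · intro L hL
    have : L.map N.subtype = ⊥ := by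
      refine hN _ (Submodule.map_subtype_le N L) ?_
      rw [Submodule.disjoint_def]
      rintro _ ⟨x, hx, rfl⟩ ⟨p, hp⟩
      have : x ∈ L ⊓ LinearMap.range (f.codRestrict N fun x => hfN ⟨x, rfl⟩) :=
        ⟨hx, p, Subtype.ext hp⟩
      rw [hL, Submodule.mem_bot] at this
      rw [this, map_zero]
    exact Submodule.map_injective_of_injective N.injective_subtype
      (this.trans (Submodule.map_bot N.subtype).symm)

theorem exists_isInjectiveEnvelope (P : Type u) [AddCommGroup P] [Module R P] :
    ∃ (E : Type u) (_ : AddCommGroup E) (_ : Module R E) (f : P →ₗ[R] E),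
      IsInjectiveEnvelope f := by
  obtain ⟨f, hf⟩ := exists_embedding_characterModule R P
  obtain ⟨N, g, hg⟩ := exists_isInjectiveEnvelope_of_injective
    (injective_characterModule (CharacterCover R P)) f hf
  exact ⟨N, inferInstance, inferInstance, g, hg⟩

end

/-! ### Finitely presented modules -/

section

variable {R : Type u} [Ring R]

theorem equational_of_free (F : Type u) [AddCommGroup F] [Module R F] [Module.Free R F] :
    Equational R F := by
  classical
  intro k m C y hy
  let B := Module.Free.chooseBasis R F
  let S := Finset.univ.biUnion fun j => (B.repr (y j)).support
  refine ⟨S.card, Matrix.of fun j l => B.repr (y j) (S.equivFin.symm l),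
    fun l => B (S.equivFin.symm l), ?_, fun j => ?_⟩
  · ext i l
    have := congrArg (fun t => B.repr t (S.equivFin.symm l)) (hy i)
    simpa [Matrix.mul_apply, Finsupp.finsetSum_apply] using this
  · simp only [Matrix.of_apply]
    rw [S.equivFin.symm.sum_comp fun s : S => B.repr (y j) s • B s,
      Finset.sum_coe_sort S fun s => B.repr (y j) s • B s]
    conv_lhs => rw [← B.linearCombination_repr (y j), Finsupp.linearCombination_apply]
    refine Finsupp.sum_of_support_subset _ ?_ _ (by simp)
    exact Finset.subset_biUnion_of_mem (fun j => (B.repr (y j)).support) (Finset.mem_univ j)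

theorem rowSpacesAreAnnihilators_of_embedding
    (h : ∀ (P : Type u) [AddCommGroup P] [Module R P], Module.FinitePresentation R P →
      ∃ (F : Type u) (_ : AddCommGroup F) (_ : Module R F) (f : P →ₗ[R] F),
        Equational R F ∧ Function.Injective f) : RowSpacesAreAnnihilators R := by
  intro k m C
  let K := LinearMap.range C.vecMulLinear
  have hK : K.FG := by
    rw [show K = _ from LinearMap.range_eq_map _]
    exact Submodule.FG.map _ Module.Finite.fg_top
  obtain ⟨F, _, _, f, hF, hf⟩ := h ((Fin m → R) ⧸ K)
    (Module.finitePresentation_of_surjective K.mkQ K.mkQ_surjective (by rwa [Submodule.ker_mkQ]))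
  let y : Fin m → F := fun j => f (K.mkQ (Pi.single j 1))
  have hy : ∀ x : Fin m → R, ∑ j, x j • y j = f (K.mkQ x) := by
    intro x
    simp only [y, ← map_smul, ← map_sum]
    congr 2
    ext i
    simp [Finset.sum_apply, Pi.single_apply]
  obtain ⟨p, T, z, hT, hz⟩ := hF k m C y fun i => by
    rw [hy (C i)]
    have : C i ∈ K := ⟨Pi.single i 1, by simp [Matrix.row]⟩
    rw [Submodule.mkQ_apply, (Submodule.Quotient.mk_eq_zero K).2 this, map_zero]
  refine ⟨p, T, hT, fun x hx => ?_⟩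
  have h₀ : f (K.mkQ x) = 0 := by
    rw [← hy]
    simp_rw [hz, Finset.smul_sum, ← mul_smul]
    rw [Finset.sum_comm]
    simp_rw [← Finset.sum_smul]
    refine Finset.sum_eq_zero fun l _ => ?_
    rw [show ∑ j, x j * T j l = 0 from congrFun hx l, zero_smul]
  rw [map_eq_zero_iff f hf, Submodule.mkQ_apply, Submodule.Quotient.mk_eq_zero] at h₀
  obtain ⟨y, hy⟩ := h₀
  exact ⟨y, hy.symm⟩

theorem RowSpacesAreAnnihilators.exists_embedding (h : RowSpacesAreAnnihilators R) (P : Type u)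
    [AddCommGroup P] [Module R P] (hP : Module.FinitePresentation R P) :
    ∃ (F : Type u) (_ : AddCommGroup F) (_ : Module R F) (f : P →ₗ[R] F),
      Module.Free R F ∧ Function.Injective f := by
  obtain ⟨n, m, f, g, hf, hfg⟩ := Module.FinitePresentation.exists_fin' R P
  let C : Matrix (Fin m) (Fin n) R := Matrix.of fun i => g (Pi.single i 1)
  have hg : ∀ y, g y = y ᵥ* C := by
    have : g = C.vecMulLinear := by
      refine LinearMap.pi_ext' fun i => LinearMap.ext_ring ?_
      ext j
      simp [C]
    intro y
    rw [this, vecMulLinear_apply]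
  obtain ⟨p, T, hT, h⟩ := h m n C
  have hker : LinearMap.ker f = LinearMap.ker T.vecMulLinear := by
    ext x
    rw [LinearMap.mem_ker, LinearMap.mem_ker, vecMulLinear_apply, hfg x]
    constructor
    · rintro ⟨y, rfl⟩
      rw [hg, vecMul_vecMul, hT, vecMul_zero]
    · intro hx
      obtain ⟨y, hy⟩ := h x hx
      exact ⟨y, by rw [hg, hy]⟩
  let e := (LinearMap.quotKerEquivOfSurjective f hf).symm
  refine ⟨Fin p → R, inferInstance, inferInstance,
    (LinearMap.ker f).liftQ T.vecMulLinear hker.le ∘ₗ e.toLinearMap, inferInstance, ?_⟩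
  rw [LinearMap.coe_comp]
  refine Function.Injective.comp ?_ e.injective
  rw [← LinearMap.ker_eq_bot]
  exact Submodule.ker_liftQ_eq_bot' _ _ hker

/-- A solution `y` is a map from the cokernel of `C` to `E`. As `T` embeds this cokernel into `R^p`,
the map extends to `R^p`, and `z` consists of the images of the unit vectors. -/
theorem RowSpacesAreAnnihilators.equational_of_injective (h : RowSpacesAreAnnihilators R)
    (E : Type u) [AddCommGroup E] [Module R E] (hE : Module.Injective R E) : Equational R E := by
  intro k m C y hy
  obtain ⟨p, T, hT, h⟩ := h k m C
  let v : (Fin m → R) →ₗ[R] E := Fintype.linearCombination R y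
  have hv : LinearMap.ker T.vecMulLinear ≤ LinearMap.ker v := by
    intro x hx
    obtain ⟨w, rfl⟩ := h x hx
    rw [LinearMap.mem_ker, Fintype.linearCombination_apply]
    simp_rw [vecMul, dotProduct, Finset.sum_smul, mul_smul]
    rw [Finset.sum_comm]
    simp_rw [← Finset.smul_sum, hy, smul_zero, Finset.sum_const_zero]
  obtain ⟨g, hg⟩ := hE.out ((LinearMap.ker T.vecMulLinear).liftQ T.vecMulLinear le_rfl)
    (by rw [← LinearMap.ker_eq_bot]; exact Submodule.ker_liftQ_eq_bot' _ _ rfl)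
    ((LinearMap.ker T.vecMulLinear).liftQ v hv)
  refine ⟨p, T, fun l => g (Pi.single l 1), hT, fun j => ?_⟩
  have h₁ : g (T j) = y j := by
    have := hg (Submodule.Quotient.mk (Pi.single j 1))
    simp only [Submodule.liftQ_apply, vecMulLinear_apply, single_one_vecMul] at this
    simpa [v, Matrix.row] using this
  rw [← h₁]
  simp_rw [← map_smul, ← map_sum]
  congr 1
  ext i
  simp [Finset.sum_apply, Pi.single_apply]

end

/-! ### Matrices acting on tuples -/

section

variable {R : Type u} [Ring R] {ι κ μ : Type*}

/-- The product of a matrix with a column over a left module. -/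
def leftAct [Fintype κ] {M : Type*} [AddCommGroup M] [Module R M] (A : Matrix ι κ R)
    (y : κ → M) : ι → M :=
  fun i => ∑ j, A i j • y j

/-- The product of a row over a right module with a matrix. -/
def rightAct [Fintype ι] {M : Type*} [AddCommGroup M] [Module Rᵐᵒᵖ M] (y : ι → M)
    (C : Matrix ι κ R) : κ → M :=
  fun j => ∑ i, MulOpposite.op (C i j) • y i

theorem leftAct_mul [Fintype κ] [Fintype μ] {M : Type*} [AddCommGroup M] [Module R M]
    (A : Matrix ι κ R) (B : Matrix κ μ R) (y : μ → M) : leftAct (A * B) y = leftAct A (leftAct B y) := by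
  ext i
  simp only [leftAct, Matrix.mul_apply, Finset.sum_smul, Finset.smul_sum, mul_smul]
  exact Finset.sum_comm

theorem rightAct_mul [Fintype ι] [Fintype κ] {M : Type*} [AddCommGroup M] [Module Rᵐᵒᵖ M]
    (y : ι → M) (C : Matrix ι κ R) (D : Matrix κ μ R) : rightAct y (C * D) = rightAct (rightAct y C) D := by
  ext i
  simp only [rightAct, Matrix.mul_apply, Finset.op_sum, Finset.sum_smul, Finset.smul_sum,
    MulOpposite.op_mul, mul_smul]
  exact Finset.sum_comm

theorem leftAct_one [Fintype κ] {M : Type*} [AddCommGroup M] [Module R M] [DecidableEq κ]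
    (y : κ → M) :
    leftAct (1 : Matrix κ κ R) y = y := by
  ext i
  simp [leftAct, Matrix.one_apply]

theorem rightAct_one [Fintype κ] {M : Type*} [AddCommGroup M] [Module Rᵐᵒᵖ M] [DecidableEq κ]
    (y : κ → M) :
    rightAct y (1 : Matrix κ κ R) = y := by
  ext i
  simp [rightAct, Matrix.one_apply, apply_ite MulOpposite.op]

@[simp] theorem rightAct_zero [Fintype ι] {M : Type*} [AddCommGroup M] [Module Rᵐᵒᵖ M] (y : ι → M) :
    rightAct y (0 : Matrix ι κ R) = 0 := by
  ext i
  simp [rightAct]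

theorem rightAct_self [Fintype ι] (y : ι → R) (C : Matrix ι κ R) : rightAct y C = y ᵥ* C := rfl

theorem map_rightAct [Fintype ι] {M N : Type*} [AddCommGroup M] [Module Rᵐᵒᵖ M] [AddCommGroup N]
    [Module Rᵐᵒᵖ N] (f : M →ₗ[Rᵐᵒᵖ] N) (y : ι → M) (C : Matrix ι κ R) :
    rightAct (fun i => f (y i)) C = fun j => f (rightAct y C j) := by
  ext j
  simp [rightAct]

theorem map_leftAct [Fintype κ] {M N : Type*} [AddCommGroup M] [Module R M] [AddCommGroup N]
    [Module R N] (f : M →ₗ[R] N) (A : Matrix ι κ R) (y : κ → M) :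
    leftAct A (fun i => f (y i)) = fun j => f (leftAct A y j) := by
  ext j
  simp [leftAct]

/-- A row of scalars times a column over a left module. -/
def pairing [Fintype ι] {M : Type*} [AddCommGroup M] [Module R M] (z : ι → R) (v : ι → M) : M :=
  ∑ i, z i • v i

theorem pairing_vecMul [Fintype ι] [Fintype κ] {M : Type*} [AddCommGroup M] [Module R M]
    (z : ι → R) (A : Matrix ι κ R) (y : κ → M) : pairing (z ᵥ* A) y = pairing z (leftAct A y) := by
  simp only [pairing, leftAct, vecMul, dotProduct, Finset.sum_smul, Finset.smul_sum, mul_smul]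
  exact Finset.sum_comm

@[simp] theorem zero_pairing [Fintype ι] {M : Type*} [AddCommGroup M] [Module R M] (v : ι → M) :
    pairing (0 : ι → R) v = 0 := by
  simp [pairing]

theorem pairing_single [Fintype ι] {M : Type*} [AddCommGroup M] [Module R M] [DecidableEq ι]
    (f : (ι → R) →ₗ[R] M) (w : ι → R) : pairing w (fun i => f (Pi.single i 1)) = f w := by
  simp only [pairing, ← map_smul, ← map_sum]
  congr 1
  ext i
  simp [Finset.sum_apply, Pi.single_apply]

/-- Multiplication of columns by a matrix, as a homomorphism of right modules. -/
def mulVecRight [Fintype κ] (C : Matrix ι κ R) : (κ → R) →ₗ[Rᵐᵒᵖ] (ι → R) where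
  toFun := C.mulVec
  map_add' := mulVec_add C
  map_smul' r w := mulVec_smul C r w

@[simp] theorem mulVecRight_apply [Fintype κ] (C : Matrix ι κ R) (w : κ → R) :
    mulVecRight C w = C *ᵥ w := rfl

theorem rightAct_single [Fintype ι] {M : Type*} [AddCommGroup M] [Module Rᵐᵒᵖ M] [DecidableEq ι]
    (f : (ι → R) →ₗ[Rᵐᵒᵖ] M) (C : Matrix ι κ R) (j : κ) :
    rightAct (fun i => f (Pi.single i 1)) C j = f (fun i => C i j) := by
  simp only [rightAct, ← map_smul, ← map_sum]
  congr 1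
  ext i
  simp [Finset.sum_apply, Pi.single_apply]

end

/-! ### Solution sets -/

section

variable {R : Type u} [Ring R] {M : Type u} [AddCommGroup M]

theorem LeftPP.mem_sol [Module R M] {n : ℕ} (φ : LeftPP R n) (x : Fin n → M) :
    x ∈ φ.sol M ↔ ∃ y, leftAct φ.A y = leftAct φ.B x :=
  exists_congr fun _ => funext_iff.symm

theorem RightPP.mem_sol [Module Rᵐᵒᵖ M] {n : ℕ} (ψ : RightPP R n) (x : Fin n → M) :
    x ∈ ψ.sol M ↔ ∃ y, rightAct y ψ.C = rightAct x ψ.D :=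
  exists_congr fun _ => funext_iff.symm

theorem LeftPP.mem_sol_divisibility [Module R M] {n k : ℕ} (A : Matrix (Fin n) (Fin k) R)
    (x : Fin n → M) : x ∈ (LeftPP.divisibility A).sol M ↔ ∃ y, leftAct A y = x := by
  rw [LeftPP.mem_sol]
  change (∃ y, leftAct A y = leftAct 1 x) ↔ _
  rw [leftAct_one]

theorem RightPP.mem_sol_annihilation [Module Rᵐᵒᵖ M] {n m : ℕ} (A : Matrix (Fin n) (Fin m) R)
    (x : Fin n → M) : x ∈ (RightPP.annihilation A).sol M ↔ rightAct x A = 0 := by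
  rw [RightPP.mem_sol]
  change (∃ y : Fin 0 → M, rightAct y (0 : Matrix (Fin 0) (Fin m) R) = rightAct x A) ↔ _
  simp [eq_comm]

/-! ### Absolutely pure modules -/

/-- A solution of `A y = v` is adjoined freely to `M`; the compatibility condition `h` says exactly
that `M` still embeds. Purity brings a solution back to `M`. -/
theorem AbsPureLeft.exists_leftAct_eq [Module R M] (hM : AbsPureLeft R M) {m k : ℕ}
    (A : Matrix (Fin m) (Fin k) R) (v : Fin m → M)
    (h : ∀ z : Fin m → R, z ᵥ* A = 0 → pairing z v = 0) : ∃ y, leftAct A y = v := by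
  let ρ : (Fin m → R) →ₗ[R] M × (Fin k → R) :=
    (Fintype.linearCombination R v).prod (-A.vecMulLinear)
  let N := (M × (Fin k → R)) ⧸ LinearMap.range ρ
  let q : M × (Fin k → R) →ₗ[R] N := (LinearMap.range ρ).mkQ
  have hq : ∀ t, q t = 0 ↔ ∃ z, ρ z = t := fun t => Submodule.Quotient.mk_eq_zero _
  let f : M →ₗ[R] N := q ∘ₗ LinearMap.inl R M (Fin k → R)
  have hf : Function.Injective f := by
    rw [injective_iff_map_eq_zero]
    intro a ha
    obtain ⟨z, hz⟩ := (hq _).1 ha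
    rw [← show pairing z v = a from congrArg Prod.fst hz]
    exact h z (neg_eq_zero.1 (congrArg Prod.snd hz))
  have hsol : (fun i => f (v i)) ∈ (LeftPP.divisibility A).sol N := by
    rw [LeftPP.mem_sol_divisibility]
    refine ⟨fun j => (q ∘ₗ LinearMap.inr R M (Fin k → R)) (Pi.single j 1), funext fun i => ?_⟩
    refine (pairing_single (q ∘ₗ LinearMap.inr R M (Fin k → R)) (A i)).trans ?_
    refine Eq.symm (sub_eq_zero.1 ?_)
    rw [LinearMap.comp_apply, LinearMap.comp_apply, ← map_sub, hq]
    refine ⟨Pi.single i 1, ?_⟩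
    simp [ρ, Matrix.row]
  exact (LeftPP.mem_sol_divisibility A v).1 ((hM N f hf).2 m _ v hsol)

theorem absPureLeft_of_injective [Module R M] (hM : Module.Injective R M) : AbsPureLeft R M := by
  intro N _ _ f hf
  obtain ⟨g, hg⟩ := hM.out f hf LinearMap.id
  refine ⟨hf, fun n φ x hx => ?_⟩
  rw [LeftPP.mem_sol] at hx ⊢
  obtain ⟨y, hy⟩ := hx
  refine ⟨fun j => g (y j), ?_⟩
  rw [map_leftAct, hy, map_leftAct]
  ext i
  exact hg _

theorem AbsPureRight.exists_vecMul_eq (hR : AbsPureRight R R) {k : ℕ} {μ : Type*} [Fintype μ]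
    (C : Matrix (Fin k) μ R) (x : μ → R) (h : ∀ w, C *ᵥ w = 0 → x ⬝ᵥ w = 0) :
    ∃ y, y ᵥ* C = x := by
  classical
  -- Again a solution is adjoined freely, now of `y C = x`. The factor `Unit → R` is `R` itself,
  -- with `x` viewed as a one-row matrix.
  let ρ : (μ → R) →ₗ[Rᵐᵒᵖ] (Unit → R) × (Fin k → R) :=
    (mulVecRight (Matrix.of fun _ => x)).prod (-mulVecRight C)
  let N := ((Unit → R) × (Fin k → R)) ⧸ LinearMap.range ρ
  let q : (Unit → R) × (Fin k → R) →ₗ[Rᵐᵒᵖ] N := (LinearMap.range ρ).mkQ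
  have hq : ∀ t, q t = 0 ↔ ∃ z, ρ z = t := fun t => Submodule.Quotient.mk_eq_zero _
  let f : R →ₗ[Rᵐᵒᵖ] N := q ∘ₗ LinearMap.inl Rᵐᵒᵖ (Unit → R) (Fin k → R) ∘ₗ
    LinearMap.pi fun _ => LinearMap.id
  have hf : Function.Injective f := by
    rw [injective_iff_map_eq_zero]
    intro a ha
    obtain ⟨z, hz⟩ := (hq _).1 ha
    rw [← show x ⬝ᵥ z = a from congrFun (congrArg Prod.fst hz) ()]
    exact h z (neg_eq_zero.1 (congrArg Prod.snd hz))
  let e := Fintype.equivFin μ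
  let ψ : RightPP R (Fintype.card μ) := ⟨k, Fintype.card μ, C.submatrix id e.symm, 1⟩
  have hsol : (fun j => f (x (e.symm j))) ∈ ψ.sol N := by
    rw [RightPP.mem_sol]
    refine ⟨fun i => (q ∘ₗ LinearMap.inr Rᵐᵒᵖ (Unit → R) (Fin k → R)) (Pi.single i 1), ?_⟩
    change _ = rightAct _ (1 : Matrix _ _ R)
    rw [rightAct_one]
    ext j
    rw [rightAct_single]
    refine Eq.symm (sub_eq_zero.1 ?_)
    change q _ - q _ = 0
    rw [← map_sub, hq]
    refine ⟨Pi.single (e.symm j) 1, ?_⟩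
    ext i <;> simp [ρ, ψ]
  have := (hR N f hf).2 _ ψ _ hsol
  rw [RightPP.mem_sol] at this
  obtain ⟨y, hy⟩ := this
  refine ⟨y, funext fun j => ?_⟩
  have hy' : rightAct y (C.submatrix id e.symm) = fun j => x (e.symm j) := by
    rw [← rightAct_one (R := R) fun j => x (e.symm j)]
    exact hy
  simpa [rightAct_self, vecMul, dotProduct] using congrFun hy' (e j)

/-- If `y C = x D` is solvable in an extension, multiplying by `T` gives `x D T = 0` already in `R`,
so `x D` is in the row space of `C`. -/
theorem RowSpacesAreAnnihilators.absPureRight (h : RowSpacesAreAnnihilators R) :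
    AbsPureRight R R := by
  intro N _ _ f hf
  refine ⟨hf, fun n ψ x hx => ?_⟩
  rw [RightPP.mem_sol] at hx ⊢
  obtain ⟨y, hy⟩ := hx
  obtain ⟨p, T, hT, h⟩ := h _ _ ψ.C
  obtain ⟨z, hz⟩ := h (x ᵥ* ψ.D) (by
    ext l
    apply hf
    have := congrArg (fun t => rightAct t T l) hy
    rw [← rightAct_mul, hT, rightAct_zero, map_rightAct, map_rightAct] at this
    exact this.symm.trans (map_zero f).symm)
  exact ⟨z, hz.symm⟩

/-! ### Divisibility formulas -/

/-- The condition on divisibility formulas in terms of matrices: below `∃ y (A y = B x)` there is a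
divisibility formula whose matrix is annihilated on the left only by the rows `z B` with
`z A = 0`. -/
def DividesRows (R : Type u) [Ring R] (n : ℕ) : Prop :=
  ∀ (k m : ℕ) (A : Matrix (Fin m) (Fin k) R) (B : Matrix (Fin m) (Fin n) R),
    ∃ (p : ℕ) (A' : Matrix (Fin n) (Fin p) R) (Y : Matrix (Fin k) (Fin p) R),
      A * Y = B * A' ∧ ∀ w, w ᵥ* A' = 0 → ∃ z, z ᵥ* A = 0 ∧ z ᵥ* B = w

/-- Separate the rows `(0 1)` modulo the rows `(A B)`: `(0, w)` lies in the row space of `(A B)`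
exactly when `w = z B` for some `z` with `z A = 0`. -/
theorem SeparatesRows.dividesRows {n : ℕ} (h : SeparatesRows R n) : DividesRows R n := by
  intro k m A B
  obtain ⟨p, T, hT, h⟩ := h.separates (fromCols A B) (fromCols 0 1)
  obtain ⟨T₁, T₂, rfl⟩ : ∃ T₁ T₂, T = fromRows T₁ T₂ :=
    ⟨toRows₁ T, toRows₂ T, (fromRows_toRows T).symm⟩
  rw [fromCols_mul_fromRows] at hT h
  rw [Matrix.zero_mul, Matrix.one_mul, zero_add] at h
  refine ⟨p, T₂, -T₁, ?_, fun w hw => ?_⟩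
  · rw [Matrix.mul_neg, neg_eq_iff_add_eq_zero, hT]
  · obtain ⟨z, hz⟩ := h w hw
    rw [vecMul_fromCols, vecMul_fromCols, vecMul_zero, vecMul_one] at hz
    exact ⟨z, funext fun j => (congrFun hz (Sum.inl j)).symm,
      funext fun j => (congrFun hz (Sum.inr j)).symm⟩

/-- The relevant formula is `∃ y (C y = 0 ∧ D y = x)`; a row killing its divisibility matrix
expresses `x D` through the rows of `C`. -/
theorem DividesRows.separatesRows {n : ℕ} (h : DividesRows R n) : SeparatesRows R n := by
  intro k m C D
  let e : Fin k ⊕ Fin n ≃ Fin (k + n) := finSumFinEquiv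
  obtain ⟨p, A', Y, hY, h⟩ := h m (k + n) ((fromRows C D).submatrix e.symm id)
    ((fromRows 0 1).submatrix e.symm id)
  have hY' : fromRows (C * Y) (D * Y) = fromRows 0 A' := by
    ext i j
    have := congrFun (congrFun hY (e i)) j
    rcases i with i | i <;> simpa [Matrix.mul_apply, Matrix.one_apply] using this
  obtain ⟨hC, hD⟩ := fromRows_inj.eq_iff.1 hY'
  refine ⟨p, Y, hC, fun x hx => ?_⟩
  rw [hD] at hx
  obtain ⟨z, hz, rfl⟩ := h x hx
  have key : ∀ {μ : Type} (X : Matrix (Fin k) μ R) (X' : Matrix (Fin n) μ R),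
      z ᵥ* (fromRows X X').submatrix e.symm id =
        (fun i => z (e (Sum.inl i))) ᵥ* X + (fun i => z (e (Sum.inr i))) ᵥ* X' := by
    intro μ X X'
    ext j
    simp only [vecMul, dotProduct, submatrix_apply, id, Pi.add_apply]
    rw [← e.sum_comp]
    simp [Fintype.sum_sum_type]
  rw [key] at hz
  rw [key, vecMul_zero, vecMul_one, zero_add]
  exact ⟨-fun i => z (e (Sum.inl i)), by rw [neg_vecMul]; exact eq_neg_of_add_eq_zero_right hz⟩

theorem DividesRows.divisibilityCondition {n : ℕ} (h : DividesRows R n) :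
    DivisibilityCondition R n := by
  intro φ
  obtain ⟨p, A', Y, hY, h⟩ := h _ _ φ.A φ.B
  have hbelow : (LeftPP.divisibility A').Below φ := by
    intro M _ _ x hx
    rw [LeftPP.mem_sol_divisibility] at hx
    obtain ⟨y, rfl⟩ := hx
    rw [LeftPP.mem_sol]
    exact ⟨leftAct Y y, by rw [← leftAct_mul, hY, leftAct_mul]⟩
  refine ⟨p, A', hbelow, fun M _ _ hM => (Set.Subset.antisymm (hbelow M) fun x hx => ?_).symm⟩
  rw [LeftPP.mem_sol] at hx
  obtain ⟨y, hy⟩ := hx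
  rw [LeftPP.mem_sol_divisibility]
  refine hM.exists_leftAct_eq A' x fun w hw => ?_
  obtain ⟨z, hz, rfl⟩ := h w hw
  rw [pairing_vecMul, ← hy, ← pairing_vecMul, hz, zero_pairing]

theorem dividesRows_of_divisibilityCondition {n : ℕ} (h : DivisibilityCondition R n) :
    DividesRows R n := by
  intro k m A B
  obtain ⟨p, A', hbelow, h⟩ := h ⟨k, m, A, B⟩
  -- The rows of `A'` are the generic solution of `A' | x`, witnessed by the unit vectors.
  have hfree : A' ∈ LeftPP.sol ⟨k, m, A, B⟩ (Fin p → R) := by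
    refine hbelow _ ((LeftPP.mem_sol_divisibility A' _).2 ⟨fun j => Pi.single j 1, ?_⟩)
    ext i : 1
    exact pairing_single LinearMap.id (A' i)
  obtain ⟨Y, hY⟩ := hfree
  refine ⟨p, A', Matrix.of Y, ?_, fun w hw => ?_⟩
  · ext i j
    simpa [Matrix.mul_apply, Finset.sum_apply] using congrFun (hY i) j
  -- In an injective module containing `R^n / K`, the images of the unit vectors satisfy the
  -- formula, since `K` is exactly the obstruction to solving it. Divisibility by `A'` then puts
  -- every `w` with `w A' = 0` into `K`.
  let K := (LinearMap.ker A.vecMulLinear).map B.vecMulLinear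
  obtain ⟨f, hf⟩ := exists_embedding_characterModule R ((Fin n → R) ⧸ K)
  have hE := absPureLeft_of_injective
    (injective_characterModule (R := R) (CharacterCover R ((Fin n → R) ⧸ K)))
  let g := f ∘ₗ K.mkQ
  have hg : ∀ x, g x = 0 ↔ x ∈ K := by
    intro x
    rw [LinearMap.comp_apply, map_eq_zero_iff f hf]
    exact Submodule.Quotient.mk_eq_zero _
  have hx : (fun i => g (Pi.single i 1)) ∈ LeftPP.sol ⟨k, m, A, B⟩ _ := by
    rw [LeftPP.mem_sol]
    refine hE.exists_leftAct_eq A _ fun z hz => ?_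
    change pairing z (leftAct B _) = 0
    rw [← pairing_vecMul, pairing_single, hg]
    exact ⟨z, hz, rfl⟩
  rw [h _ hE, LeftPP.mem_sol_divisibility] at hx
  obtain ⟨y, hy⟩ := hx
  have hw' : g w = 0 := by
    rw [← pairing_single g w, ← hy, ← pairing_vecMul, hw, zero_pairing]
  obtain ⟨z, hz, hzw⟩ := (hg w).1 hw'
  exact ⟨z, hz, hzw⟩

/-! ### Annihilation formulas -/

theorem SeparatesRows.annihilationCondition {n : ℕ} (h : SeparatesRows R n) :
    AnnihilationCondition R n := by
  intro ψ
  obtain ⟨p, T, hT, h⟩ := h _ _ ψ.C ψ.D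
  have hbelow : ψ.Below (RightPP.annihilation (ψ.D * T)) := by
    intro M _ _ x hx
    obtain ⟨y, hy⟩ := (RightPP.mem_sol ψ x).1 hx
    rw [RightPP.mem_sol_annihilation, rightAct_mul, ← hy, ← rightAct_mul, hT, rightAct_zero]
  refine ⟨p, ψ.D * T, hbelow, fun F _ _ hF => Set.Subset.antisymm (hbelow F) fun x hx => ?_⟩
  rw [RightPP.mem_sol_annihilation] at hx
  -- Flatness reduces `x` to the rows of `X`, solutions of the annihilation formula in `R`, where
  -- separation applies.
  obtain ⟨q, X, z, hX, hz⟩ := hF.equational (ψ.D * T) x (congrFun hx)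
  choose y hy using fun l => h (X l) (congrFun hX l)
  have hXY : Matrix.of y * ψ.C = X * ψ.D := by
    ext l j
    exact (congrFun (hy l) j).symm
  have hzx : x = rightAct z X := funext hz
  rw [RightPP.mem_sol]
  exact ⟨rightAct z (Matrix.of y), by rw [← rightAct_mul, hXY, rightAct_mul, hzx]⟩

theorem separatesRows_of_annihilationCondition {n : ℕ} (h : AnnihilationCondition R n) :
    SeparatesRows R n := by
  intro k m C D
  obtain ⟨p, A, hbelow, h⟩ := h ⟨k, m, C, D⟩
  -- The cokernel of `ρ` carries the generic solution of `y C = x D`. That it satisfies `x A = 0`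
  -- provides columns `w` with `C w = 0` and `-D w` a column of `A`; the flat module `R` then tests
  -- the converse.
  let ρ : (Fin m → R) →ₗ[Rᵐᵒᵖ] (Fin k → R) × (Fin n → R) :=
    (mulVecRight C).prod (-mulVecRight D)
  let q := (LinearMap.range ρ).mkQ
  have hq : ∀ t, q t = 0 ↔ ∃ z, ρ z = t := fun t => Submodule.Quotient.mk_eq_zero _
  let x := fun i => (q ∘ₗ LinearMap.inr Rᵐᵒᵖ (Fin k → R) (Fin n → R)) (Pi.single i 1)
  have hx : x ∈ RightPP.sol ⟨k, m, C, D⟩ _ := by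
    rw [RightPP.mem_sol]
    refine ⟨fun i => (q ∘ₗ LinearMap.inl Rᵐᵒᵖ (Fin k → R) (Fin n → R)) (Pi.single i 1), ?_⟩
    ext j
    rw [rightAct_single, rightAct_single, ← sub_eq_zero, LinearMap.comp_apply,
      LinearMap.comp_apply, ← map_sub, hq]
    refine ⟨Pi.single j 1, ?_⟩
    ext i <;> simp [ρ]
  have hxA := (RightPP.mem_sol_annihilation A x).1 (hbelow _ hx)
  have hcol : ∀ j, ∃ w, ρ w = (0, fun i => A i j) := by
    intro j
    have := congrFun hxA j
    rw [rightAct_single] at this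
    exact (hq _).1 this
  choose w hw using hcol
  refine ⟨p, Matrix.of fun i j => w j i, ?_, fun y hy => ?_⟩
  · ext i j
    exact congrFun (congrArg Prod.fst (hw j)) i
  · have hDA : D * Matrix.of (fun i j => w j i) = -A := by
      ext i j
      have := congrFun (congrArg Prod.snd (hw j)) i
      exact neg_eq_iff_eq_neg.1 this
    rw [hDA, vecMul_neg, neg_eq_zero] at hy
    have hy' : y ∈ (RightPP.annihilation A).sol R := (RightPP.mem_sol_annihilation A y).2 hy
    rw [← h R (flatRight_self R), RightPP.mem_sol] at hy'
    obtain ⟨z, hz⟩ := hy'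
    exact ⟨z, hz.symm⟩

/-! ### Absolute purity and a-coherence of the ring -/

theorem DividesRows.rightACoherent (h : DividesRows R 1) : RightACoherent R := by
  intro φ
  obtain ⟨p, A', Y, hY, h⟩ := h _ _ φ.A φ.B
  let I₀ : Submodule Rᵐᵒᵖ R := Submodule.span Rᵐᵒᵖ (Set.range (A' 0))
  have hI₀ : ∀ b ∈ I₀, (fun _ => b) ∈ φ.sol R := by
    intro b hb
    obtain ⟨c, rfl⟩ := (Submodule.mem_span_range_iff_exists_fun _).1 hb
    rw [LeftPP.mem_sol]
    refine ⟨leftAct Y fun l => (c l).unop, ?_⟩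
    rw [← leftAct_mul, hY, leftAct_mul]
    congr 1
    ext i
    rw [Subsingleton.elim i 0]
    simp [leftAct]
  refine ⟨I₀, ⟨(Set.finite_range (A' 0)).toFinset, by simp [I₀]⟩, hI₀, ?_⟩
  ext a
  refine ⟨fun ha b hb => ha b (hI₀ b hb), fun ha b hb => ?_⟩
  obtain ⟨z, hz, hza⟩ := h (fun _ => a) (by
    ext l
    simpa [vecMul, dotProduct] using ha (A' 0 l) (Submodule.subset_span ⟨l, rfl⟩))
  obtain ⟨y, hy⟩ := (LeftPP.mem_sol φ _).1 hb
  have : pairing (fun _ : Fin 1 => a) (fun _ => b) = 0 := by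
    rw [← hza, pairing_vecMul, ← hy, ← pairing_vecMul, hz, zero_pairing]
  simpa [pairing] using this

theorem dividesRows_of_absPureRight (hR : AbsPureRight R R) (hc : RightACoherent R) :
    DividesRows R 1 := by
  intro k m A B
  obtain ⟨I₀, hfg, hI₀, hann⟩ := hc ⟨k, m, A, B⟩
  obtain ⟨p, s, rfl⟩ := Submodule.fg_iff_exists_fin_generating_family.1 hfg
  choose Y hY using fun l => (LeftPP.mem_sol _ _).1 (hI₀ (s l) (Submodule.subset_span ⟨l, rfl⟩))
  refine ⟨p, Matrix.of fun _ l => s l, Matrix.of fun j l => Y l j, ?_, fun w hw => ?_⟩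
  · ext i l
    exact congrFun (hY l) i
  have hw₀ : w 0 ∈ {a : R | ∀ b ∈ Submodule.span Rᵐᵒᵖ (Set.range s), a * b = 0} := by
    intro b hb
    induction hb using Submodule.span_induction with
    | mem b hb =>
      obtain ⟨l, rfl⟩ := hb
      simpa [vecMul, dotProduct] using congrFun hw l
    | zero => exact mul_zero _
    | add b c _ _ hb hc => rw [mul_add, hb, hc, add_zero]
    | smul r b _ hb => rw [mul_smul_comm, hb, smul_zero]
  rw [← hann] at hw₀
  -- Since `w` annihilates `φ(R)`, the row `(0, -w)` annihilates every solution of `A y = B x`. By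
  -- absolute purity it is therefore a combination of the rows of `(A, -B)`.
  obtain ⟨z, hz⟩ := hR.exists_vecMul_eq (fromCols A (-B)) (Sum.elim 0 (-w)) (by
    intro v hv
    obtain ⟨y, x, rfl⟩ : ∃ y x, v = Sum.elim y x :=
      ⟨v ∘ Sum.inl, v ∘ Sum.inr, (Sum.elim_comp_inl_inr v).symm⟩
    rw [fromCols_mulVec_sumElim, neg_mulVec, ← sub_eq_add_neg, sub_eq_zero] at hv
    have hx : x = fun _ => x 0 := funext fun i => by rw [Subsingleton.elim i 0]
    have := hw₀ (x 0) (by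
      rw [← hx, LeftPP.mem_sol]
      exact ⟨y, hv⟩)
    simpa [dotProduct, Fintype.sum_sum_type] using this)
  rw [vecMul_fromCols, vecMul_neg] at hz
  exact ⟨z, funext fun j => congrFun hz (Sum.inl j),
    funext fun j => neg_injective (congrFun hz (Sum.inr j))⟩

end

end IFRing

/-! ### The equivalences -/

open IFRing in
theorem mainTheorem4 (R : Type u) [Ring R] :
    List.TFAE [
      -- every injective left module is flat
      ∀ (E : Type u) [AddCommGroup E] [Module R E], Module.Injective R E → FlatLeft R E,
      -- the injective envelope of every finitely presented left module is flat
      ∀ (P E : Type u) [AddCommGroup P] [Module R P] [AddCommGroup E] [Module R E]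
        (f : P →ₗ[R] E), Module.FinitePresentation R P → IsInjectiveEnvelope f → FlatLeft R E,
      -- every finitely presented left module embeds into a free left module
      ∀ (P : Type u) [AddCommGroup P] [Module R P], Module.FinitePresentation R P →
        ∃ (F : Type u) (_ : AddCommGroup F) (_ : Module R F) (f : P →ₗ[R] F),
          Module.Free R F ∧ Function.Injective f,
      -- the character module of every free right module is a flat left module
      ∀ (F : Type u) [AddCommGroup F] [Module Rᵐᵒᵖ F], Module.Free Rᵐᵒᵖ F →
        FlatLeft R (CharacterModule F),
      -- the pp condition on absolutely pure left modules, for all formulas and for unary ones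
      ∀ n : ℕ, 0 < n → DivisibilityCondition R n,
      DivisibilityCondition R 1,
      -- the pp condition on flat right modules, for all formulas and for unary ones
      ∀ n : ℕ, 0 < n → AnnihilationCondition R n,
      AnnihilationCondition R 1,
      -- `R` is right absolutely pure and right a-coherent
      AbsPureRight R R ∧ RightACoherent R] := by
  have hsep : RowSpacesAreAnnihilators R → ∀ n : ℕ, SeparatesRows R n := fun h => h.separatesRows
  have hrows : SeparatesRows R 1 → RowSpacesAreAnnihilators R := fun h => h.rowSpacesAreAnnihilators
  have hflat : RowSpacesAreAnnihilators R → ∀ (E : Type u) [AddCommGroup E] [Module R E],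
      Module.Injective R E → FlatLeft R E :=
    fun h E _ _ hE => (h.equational_of_injective E hE).flatLeft
  tfae_have 1 → 2 := fun h P E _ _ _ _ f _ hf => h E hf.injective_target
  tfae_have 2 → 1 := fun h => hflat <| rowSpacesAreAnnihilators_of_embedding fun P _ _ hP => by
    obtain ⟨E, _, _, f, hf⟩ := exists_isInjectiveEnvelope (R := R) P
    exact ⟨E, _, _, f, (h P E f hP hf).equational, hf.injective_map⟩
  tfae_have 1 → 4 := fun h F _ _ _ => h _ (injective_characterModule F)
  tfae_have 4 → 3 := fun h =>
    RowSpacesAreAnnihilators.exists_embedding <|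
      rowSpacesAreAnnihilators_of_embedding fun P _ _ _ => by
        obtain ⟨f, hf⟩ := exists_embedding_characterModule R P
        exact ⟨_, _, _, f, (h (CharacterCover R P) inferInstance).equational, hf⟩
  have hfree : (∀ (P : Type u) [AddCommGroup P] [Module R P], Module.FinitePresentation R P →
      ∃ (F : Type u) (_ : AddCommGroup F) (_ : Module R F) (f : P →ₗ[R] F),
        Module.Free R F ∧ Function.Injective f) → RowSpacesAreAnnihilators R :=
    fun h => rowSpacesAreAnnihilators_of_embedding fun P _ _ hP => by
      obtain ⟨F, _, _, f, _, hf⟩ := h P hP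
      exact ⟨F, _, _, f, equational_of_free F, hf⟩
  tfae_have 3 → 1 := fun h => hflat (hfree h)
  tfae_have 3 → 5 := fun h n _ => (hsep (hfree h) n).dividesRows.divisibilityCondition
  tfae_have 5 → 6 := fun h => h 1 one_pos
  tfae_have 6 → 3 := fun h =>
    (hrows (dividesRows_of_divisibilityCondition h).separatesRows).exists_embedding
  tfae_have 3 → 7 := fun h n _ => (hsep (hfree h) n).annihilationCondition
  tfae_have 7 → 8 := fun h => h 1 one_pos
  tfae_have 8 → 3 := fun h => (hrows (separatesRows_of_annihilationCondition h)).exists_embedding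
  tfae_have 3 → 9 := fun h =>
    ⟨(hfree h).absPureRight, (hsep (hfree h) 1).dividesRows.rightACoherent⟩
  tfae_have 9 → 3 := fun h =>
    (hrows (dividesRows_of_absPureRight h.1 h.2).separatesRows).exists_embedding
  tfae_finish
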